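/- Let $m\ge 1$ and $d\ge 0$ be integers, and let $M$ be an $m\times d$ integer matrix all of whose row sums are equal. Suppose that $$P=\{x\in\mathbb{R}^d : x\ge 0,\ Mx\le (1,\dots,1)^t\}$$ is a $d$-dimensional integral polytope, that is, the convex hull of finitely many points of $\mathbb{Z}^d$ (such a $P$ is called a $d$-dimensional regular positive reflexive polytope with representing matrix $M$). Let $k$ be the common row sum of $M$ plus $1$. For $t\ge 1$ put $L_P(t)=|tP\cap\mathbb{Z}^d|$. Then there is a (unique) polynomial $h^*(z)$ with integer coefficients, the $h^*$-polynomial of $P$, such that $$1+\sum_{t\ge 1}L_P(t)z^t=\frac{h^*(z)}{(1-z)^{d+1}}$$ as formal power series; it has degree exactly $d-k+1$ and is palindromic, that is, $z^{d-k+1}h^*(1/z)=h^*(z)$. -/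

import Mathlib

open scoped Pointwise

/-- The set `{x ∈ ℝᵈ : x ≥ 0, M x ≤ (1, …, 1)}` attached to an integer matrix `M`. -/
def positivePolyhedron {m d : ℕ} (M : Matrix (Fin m) (Fin d) ℤ) : Set (Fin d → ℝ) :=
  {x | (∀ j, 0 ≤ x j) ∧ ∀ i, ∑ j, (M i j : ℝ) * x j ≤ 1}

/-- An integral (convex) polytope in `ℝᵈ`: the convex hull of finitely many points of `ℤᵈ`. -/
def IsIntegralPolytope {d : ℕ} (P : Set (Fin d → ℝ)) : Prop :=
  ∃ V : Finset (Fin d → ℤ), P = convexHull ℝ ((fun v j => (v j : ℝ)) '' (V : Set (Fin d → ℤ)))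

/-- `P` is a `d`-dimensional positive reflexive polytope in `ℝᵈ` with representing matrix `M`. -/
structure IsPositiveReflexive {m d : ℕ} (P : Set (Fin d → ℝ))
    (M : Matrix (Fin m) (Fin d) ℤ) : Prop where
  integral : IsIntegralPolytope P
  full_dim : affineSpan ℝ P = ⊤
  eq_polyhedron : P = positivePolyhedron M

/-- `P` is a `d`-dimensional regular positive reflexive polytope with representing matrix `M`:
all row sums of `M` are equal. -/
structure IsRegularPositiveReflexive {m d : ℕ} (P : Set (Fin d → ℝ))
    (M : Matrix (Fin m) (Fin d) ℤ) : Prop extends IsPositiveReflexive P M where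
  row_sum_eq : ∀ i i' : Fin m, ∑ j, M i j = ∑ j, M i' j

/-- The number `L_S(t) = |tS ∩ ℤᵈ|` of lattice points in the dilate `tS` (`S` bounded). -/
noncomputable def latticeCount {d : ℕ} (S : Set (Fin d → ℝ)) (t : ℕ) : ℕ :=
  Set.ncard {z : Fin d → ℤ | (fun j => (z j : ℝ)) ∈ (t : ℝ) • S}

/-- The Ehrhart series `1 + ∑_{t ≥ 1} L_S(t) zᵗ`. -/
noncomputable def ehrhartSeries {d : ℕ} (S : Set (Fin d → ℝ)) : PowerSeries ℤ :=
  PowerSeries.mk fun t => if t = 0 then 1 else (latticeCount S t : ℤ)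

/-- `h` is the `h*`-polynomial of the `d`-dimensional polytope `S` in `ℝᵈ`, i.e. the numerator in
`Ehr_S(z) = h(z) / (1 - z)^(d+1)`. There is at most one such `h`. -/
def IsHStarPolynomial {d : ℕ} (S : Set (Fin d → ℝ)) (h : Polynomial ℤ) : Prop :=
  (h : PowerSeries ℤ) = (1 - PowerSeries.X) ^ (d + 1) * ehrhartSeries S

/-- `p` of degree `n` is palindromic: `zⁿ p(1/z) = p(z)`. -/
def IsPalindromic (p : Polynomial ℤ) : Prop :=
  p.reverse = p

/-!
Let `C` be the cone over `P × {1}` in `ℝᵈ × ℝ`, so that the Ehrhart series of `P` counts the lattice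
points of `C` by height. As `C` is cut out by `x ≥ 0` and `M x ≤ s`, where all rows of `M` sum to
`k - 1`, a lattice point `(x, s)` is interior to `C` exactly when `(x, s) - (1, …, 1, k)` lies in
`C`: the series of the interior is `z ^ k` times the series of `C`. By Ehrhart–Macdonald
reciprocity, the numerators over `(1 - z) ^ (d + 1)` of these two series are mirror images of each
other in degree `d + 1`, and comparing them gives both the degree and the symmetry of `h*`.

Reciprocity holds for every full-dimensional cone `C` over a lattice polytope. A generic choice of
heights on the generators triangulates `C`, the cells corresponding to the vertices of a dual
polyhedron. For generic `q` in the interior of `C`, the points from which a short step towards `q`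
stays in a given cell form a half-open simplicial cone, and these half-open cones partition `C`;
with `-q` in place of `q`, they partition the interior of `C`. The lattice points of a half-open
simplicial cone are unique translates, by `ℕ`-combinations of the generators, of those in a
half-open box, and reflecting that box in its centre exchanges the boxes for `q` and `-q`.
-/

open Filter Module Polynomial Set Topology
open scoped Function

section Perturbation

variable {𝕜 V : Type*} [Field 𝕜] [AddCommGroup V] [Module 𝕜 V]

theorem exists_forall_notMem_of_ne_top {κ : Type*} [Infinite 𝕜] [Finite κ]
    {W : κ → Submodule 𝕜 V} (hW : ∀ k, W k ≠ ⊤) : ∃ q, ∀ k, q ∉ W k := by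
  by_contra! hcover
  obtain ⟨k, hk⟩ := Subspace.exists_eq_top_of_iUnion_eq_univ (p := W) <|
    eq_univ_of_forall fun q => mem_iUnion.2 (hcover q)
  exact hW k hk

variable [LinearOrder 𝕜] [TopologicalSpace 𝕜]

theorem eventually_add_smul_notMem [OrderTopology 𝕜] {W : Submodule 𝕜 V}
    {q : V} (hq : q ∉ W) (x : V) : ∀ᶠ ε in 𝓝[>] (0 : 𝕜), x + ε • q ∉ W := by
  have hsub : {ε : 𝕜 | x + ε • q ∈ W}.Subsingleton := by
    intro a ha c hc
    by_contra hac
    have hdiff := W.sub_mem ha hc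
    rw [add_sub_add_left_eq_sub, ← sub_smul] at hdiff
    exact hq ((W.smul_mem_iff (sub_ne_zero.2 hac)).1 hdiff)
  exact (nhdsGT_le_nhdsNE 0).trans (nhdsNE_le_cofinite 0) hsub.finite.compl_mem_cofinite

theorem tendsto_add_smul_nhdsGT_zero [TopologicalSpace V] [ContinuousAdd V]
    [ContinuousSMul 𝕜 V] (x q : V) :
    Tendsto (fun ε : 𝕜 => x + ε • q) (𝓝[>] 0) (𝓝 x) := by
  have hlim : Tendsto (fun ε : 𝕜 => x + ε • q) (𝓝 0) (𝓝 (x + (0 : 𝕜) • q)) :=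
    Continuous.tendsto (by fun_prop) 0
  rw [zero_smul, add_zero] at hlim
  exact hlim.mono_left nhdsWithin_le_nhds

end Perturbation

section Triangulation

variable {𝕜 V ι : Type*} [Field 𝕜] [AddCommGroup V] [Module 𝕜 V] {v : ι → V} {w : ι → 𝕜}

/-- A point is generic with respect to the family `v` if it lies in no proper subspace spanned by
members of `v`; in particular it lies on no wall of a simplicial cone generated by such members. -/
def IsGeneric (𝕜 : Type*) {V ι : Type*} [Field 𝕜] [AddCommGroup V] [Module 𝕜 V] (v : ι → V)
    (p : V) : Prop :=
  ∀ S : Set ι, Submodule.span 𝕜 (v '' S) ≠ ⊤ → p ∉ Submodule.span 𝕜 (v '' S)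

theorem IsGeneric.neg {p : V} (hp : IsGeneric 𝕜 v p) : IsGeneric 𝕜 v (-p) :=
  fun S hS h => hp S hS (neg_mem_iff.1 h)

theorem IsGeneric.repr_ne_zero {κ : Type*} {b : Basis κ 𝕜 V} (hb : ∀ i, b i ∈ range v) {p : V}
    (hp : IsGeneric 𝕜 v p) (i : κ) : b.repr p i ≠ 0 := by
  have himage : v '' (v ⁻¹' (b '' {i}ᶜ)) = b '' {i}ᶜ :=
    image_preimage_eq_of_subset <| (image_subset_range b _).trans (range_subset_iff.2 hb)
  have hproper : Submodule.span 𝕜 (b '' {i}ᶜ) ≠ ⊤ := fun htop =>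
    b.linearIndependent.notMem_span_image (s := {i}ᶜ) (x := i) (by simp)
      (htop.symm ▸ Submodule.mem_top)
  have hp' := hp (v ⁻¹' (b '' {i}ᶜ))
  rw [himage] at hp'
  refine fun h0 => hp' hproper (b.mem_span_image.2 fun j hj hji => ?_)
  exact Finsupp.mem_support_iff.1 hj (hji ▸ h0)

variable [LinearOrder 𝕜]

theorem IsGeneric.eventually_add_smul [Finite ι] [TopologicalSpace 𝕜] [OrderTopology 𝕜] {q : V}
    (hq : IsGeneric 𝕜 v q) (x : V) : ∀ᶠ ε in 𝓝[>] (0 : 𝕜), IsGeneric 𝕜 v (x + ε • q) := by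
  refine eventually_all.2 fun S => ?_
  rw [eventually_imp_distrib_left]
  exact fun hS => eventually_add_smul_notMem (hq S hS) x

/-- The polyhedron in the dual space given by the inequalities `y (v i) ≤ w i`. -/
def dualPolyhedron (v : ι → V) (w : ι → 𝕜) : Set (Dual 𝕜 V) :=
  {y | ∀ i, y (v i) ≤ w i}

/-- The inequalities defining `dualPolyhedron v w` which are equalities at `y`. -/
def tightIndices (v : ι → V) (w : ι → 𝕜) (y : Dual 𝕜 V) : Set ι :=
  {i | y (v i) = w i}

/-- The vertices of `dualPolyhedron v w`. They index the maximal cells of the regular subdivision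
of the cone generated by `v` induced by the heights `w`. -/
def dualVertices (v : ι → V) (w : ι → 𝕜) : Set (Dual 𝕜 V) :=
  {y ∈ dualPolyhedron v w | Submodule.span 𝕜 (v '' tightIndices v w y) = ⊤}

/-- The weight `w` is generic if the members of `v` tight at any one `y` are linearly independent.
The regular subdivision it induces is then a triangulation. -/
def IsGenericWeight (v : ι → V) (w : ι → 𝕜) : Prop :=
  ∀ y, LinearIndepOn 𝕜 v (tightIndices v w y)

theorem finite_dualVertices [Finite ι] (v : ι → V) (w : ι → 𝕜) : (dualVertices v w).Finite := by
  refine Finite.of_finite_image (f := tightIndices v w) (toFinite _) fun y hy z _ hyz => ?_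
  refine LinearMap.ext_on hy.2 ?_
  rintro _ ⟨i, hi, rfl⟩
  have hiz : i ∈ tightIndices v w z := hyz ▸ hi
  exact Eq.trans hi hiz.symm

/-- The members of `v` at which the vertex `y` is tight, as a basis: the generators of the cell of
the triangulation dual to `y`. -/
noncomputable def dualVertexBasis (hw : IsGenericWeight v w) (y : dualVertices v w) :
    Basis (tightIndices v w y) 𝕜 V :=
  Basis.mk (hw y) (by rw [← image_eq_range, y.2.2])

theorem dualVertexBasis_apply (hw : IsGenericWeight v w) (y : dualVertices v w)
    (i : tightIndices v w y) : dualVertexBasis hw y i = v i :=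
  Basis.mk_apply ..

variable [IsStrictOrderedRing 𝕜]

/-- A family `b` of bases consisting of members of `v` triangulates the cone generated by `v` if
the simplicial cones generated by the `b a` cover it without overlap, up to non-generic points. -/
structure IsTriangulation {α : Type*} {κ : α → Type*} (v : ι → V)
    (b : ∀ a, Basis (κ a) 𝕜 V) : Prop where
  mem_range : ∀ a i, b a i ∈ range v
  existsUnique_mem_hull : ∀ p ∈ PointedCone.hull 𝕜 (range v), IsGeneric 𝕜 v p →
    ∃! a, p ∈ PointedCone.hull 𝕜 (range (b a))

theorem IsTriangulation.hull_range_basis_le {α : Type*} {κ : α → Type*}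
    {b : ∀ a, Basis (κ a) 𝕜 V} (hT : IsTriangulation v b) (a : α) :
    PointedCone.hull 𝕜 (range (b a)) ≤ PointedCone.hull 𝕜 (range v) :=
  Submodule.span_mono (range_subset_iff.2 (hT.mem_range a))

theorem apply_nonneg_of_mem_hull {s : Set V} {u : Dual 𝕜 V} (hu : ∀ x ∈ s, 0 ≤ u x) {p : V}
    (hp : p ∈ PointedCone.hull 𝕜 s) : 0 ≤ u p :=
  (Submodule.span_le (p := (PointedCone.positive 𝕜 𝕜).comap u)).2 hu hp

theorem mem_hull_range_basis_iff {κ : Type*} {b : Basis κ 𝕜 V} {p : V} :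
    p ∈ PointedCone.hull 𝕜 (range b) ↔ ∀ i, 0 ≤ b.repr p i := by
  refine ⟨fun hp i => ?_, fun hp => ?_⟩
  · refine apply_nonneg_of_mem_hull (u := b.coord i) (forall_mem_range.2 fun j => ?_) hp
    classical
    rw [Basis.coord_apply, b.repr_self_apply]
    split_ifs <;> simp
  · rw [← b.linearCombination_repr p, Finsupp.linearCombination_apply]
    exact Submodule.sum_mem _ fun i _ =>
      PointedCone.smul_mem _ (hp i) (PointedCone.subset_hull (mem_range_self i))

theorem exists_isGeneric_mem [Finite ι] [TopologicalSpace 𝕜] [OrderTopology 𝕜]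
    [TopologicalSpace V] [ContinuousAdd V] [ContinuousSMul 𝕜 V] (v : ι → V) {U : Set V}
    (hU : IsOpen U) (hne : U.Nonempty) : ∃ q ∈ U, IsGeneric 𝕜 v q := by
  obtain ⟨x, hx⟩ := hne
  obtain ⟨r, hr⟩ := exists_forall_notMem_of_ne_top
    (W := fun S : {S : Set ι // Submodule.span 𝕜 (v '' S) ≠ ⊤} => Submodule.span 𝕜 (v '' S.1))
    fun S => S.2
  have hgen : IsGeneric 𝕜 v r := fun S hS => hr ⟨S, hS⟩
  obtain ⟨ε, hεU, hε⟩ := (((tendsto_add_smul_nhdsGT_zero x r).eventually (hU.mem_nhds hx)).and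
    (hgen.eventually_add_smul (𝕜 := 𝕜) x)).exists
  exact ⟨_, hεU, hε⟩

theorem linearIndependent_of_forall_exists_dual {R M κ : Type*} [CommRing R] [AddCommGroup M]
    [Module R M] {u : κ → M} (h : ∀ w : κ → R, ∃ y : Dual R M, ∀ i, y (u i) = w i) :
    LinearIndependent R u := by
  classical
  rw [linearIndependent_iff']
  intro s g hg i hi
  obtain ⟨y, hy⟩ := h (Pi.single i 1)
  simpa [hy, Pi.single_apply, hi] using congrArg y hg

theorem exists_isGenericWeight_pos [Finite ι] (v : ι → V) :
    ∃ w : ι → 𝕜, (∀ i, 0 < w i) ∧ IsGenericWeight v w := by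
  let _ := Preorder.topology 𝕜
  have : OrderTopology 𝕜 := ⟨rfl⟩
  let W (S : Set ι) : Submodule 𝕜 (ι → 𝕜) :=
    (LinearMap.range (LinearMap.pi fun i : S => Dual.eval 𝕜 V (v i))).comap
      (LinearMap.funLeft 𝕜 𝕜 (↑))
  have mem_W {S : Set ι} {w : ι → 𝕜} : w ∈ W S ↔ ∃ y : Dual 𝕜 V, ∀ i : S, y (v i) = w i := by
    simp [W, funext_iff, LinearMap.funLeft_apply]
  have hW (S : Set ι) (hS : ¬ LinearIndepOn 𝕜 v S) : W S ≠ ⊤ := by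
    refine fun htop => hS (linearIndependent_of_forall_exists_dual fun w => ?_)
    obtain ⟨w, rfl⟩ := LinearMap.funLeft_surjective_of_injective 𝕜 𝕜 _ Subtype.val_injective w
    exact mem_W.1 (htop ▸ Submodule.mem_top)
  obtain ⟨r, hr⟩ := exists_forall_notMem_of_ne_top
    (W := fun S : {S : Set ι // ¬ LinearIndepOn 𝕜 v S} => W S.1) fun S => hW S.1 S.2
  have hpos : ∀ᶠ ε in 𝓝[>] (0 : 𝕜), ∀ i, 0 < 1 + ε • r i :=
    eventually_all.2 fun i => tendsto_add_smul_nhdsGT_zero 1 (r i) (lt_mem_nhds zero_lt_one)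
  obtain ⟨ε, hε, hεr⟩ := (hpos.and <|
    eventually_all.2 fun S => eventually_add_smul_notMem (hr S) 1).exists
  exact ⟨_, hε, fun y => by_contra fun hdep => hεr ⟨_, hdep⟩ <| mem_W.2 ⟨y, fun i => i.2⟩⟩

theorem exists_mem_tightIndices_add_smul [Finite ι] {y u : Dual 𝕜 V}
    (hy : y ∈ dualPolyhedron v w) (hu : ∀ i ∈ tightIndices v w y, u (v i) ≤ 0)
    (hpos : ∃ i, 0 < u (v i)) :
    ∃ t : 𝕜, 0 < t ∧ y + t • u ∈ dualPolyhedron v w ∧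
      ∃ i, 0 < u (v i) ∧ i ∈ tightIndices v w (y + t • u) := by
  obtain ⟨i, hi, hmin⟩ := exists_min_image {i | 0 < u (v i)}
    (fun i => (w i - y (v i)) / u (v i)) (toFinite _) hpos
  have hi_slack : 0 < w i - y (v i) :=
    sub_pos.2 <| (hy i).lt_of_ne fun hi' => (hu i hi').not_gt hi
  refine ⟨_, div_pos hi_slack hi, fun j => ?_, i, hi, ?_⟩
  · rw [LinearMap.add_apply, LinearMap.smul_apply, smul_eq_mul, ← le_sub_iff_add_le']
    rcases lt_or_ge 0 (u (v j)) with hj | hj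
    · exact (le_div_iff₀ hj).1 (hmin j hj)
    · exact (mul_nonpos_of_nonneg_of_nonpos (div_pos hi_slack hi).le hj).trans
        (sub_nonneg.2 (hy j))
  · rw [tightIndices, mem_ofPred_eq, LinearMap.add_apply, LinearMap.smul_apply, smul_eq_mul,
      div_mul_cancel₀ _ hi.ne', add_sub_cancel]

theorem exists_pos_of_mem_hull {p : V} (hp : p ∈ PointedCone.hull 𝕜 (range v)) {u : Dual 𝕜 V}
    (hup : 0 < u p) : ∃ i, 0 < u (v i) := by
  by_contra! hu
  have hup' : 0 ≤ (-u) p :=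
    apply_nonneg_of_mem_hull (forall_mem_range.2 fun i => neg_nonneg.2 (hu i)) hp
  exact (neg_nonneg.1 hup').not_gt hup

theorem exists_mem_dualVertices_le_apply [Finite ι] {p : V}
    (hp : p ∈ PointedCone.hull 𝕜 (range v)) (hgen : IsGeneric 𝕜 v p) {y : Dual 𝕜 V}
    (hy : y ∈ dualPolyhedron v w) : ∃ z ∈ dualVertices v w, y p ≤ z p := by
  obtain ⟨_, ⟨z, ⟨hz, hyz⟩, rfl⟩, hmax⟩ :=
    (toFinite (tightIndices v w '' {z ∈ dualPolyhedron v w | y p ≤ z p})).exists_maximal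
      ⟨_, y, ⟨hy, le_rfl⟩, rfl⟩
  refine ⟨z, ⟨hz, ?_⟩, hyz⟩
  by_contra hspan
  obtain ⟨u, hup, hu⟩ : ∃ u : Dual 𝕜 V, u p = 1 ∧ ∀ i ∈ tightIndices v w z, u (v i) = 0 := by
    obtain ⟨u, hup, hker⟩ := Submodule.exists_le_ker_of_notMem (hgen _ hspan)
    refine ⟨(u p)⁻¹ • u, inv_mul_cancel₀ hup, fun i hi => ?_⟩
    have : u (v i) = 0 := hker (Submodule.subset_span (mem_image_of_mem v hi))
    simp [this]
  obtain ⟨t, ht, hzt, j, hj, hjt⟩ := exists_mem_tightIndices_add_smul hz (fun i hi => (hu i hi).le)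
    (exists_pos_of_mem_hull hp (hup ▸ zero_lt_one))
  have hgrow : tightIndices v w z ⊆ tightIndices v w (z + t • u) := fun i hi => by
    simpa [tightIndices, hu i hi] using hi
  have hvalue : y p ≤ (z + t • u) p := by
    simpa [hup] using hyz.trans (le_add_of_nonneg_right ht.le)
  have hjz := hmax ⟨_, ⟨hzt, hvalue⟩, rfl⟩ hgrow hjt
  exact hj.ne' (hu j hjz)

theorem exists_mem_hull_dualVertexBasis [Finite ι] (hw : IsGenericWeight v w)
    (hw0 : ∀ i, 0 ≤ w i) {p : V} (hp : p ∈ PointedCone.hull 𝕜 (range v))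
    (hgen : IsGeneric 𝕜 v p) :
    ∃ y, p ∈ PointedCone.hull 𝕜 (range (dualVertexBasis hw y)) := by
  obtain ⟨z, hz, -⟩ :=
    exists_mem_dualVertices_le_apply hp hgen (show 0 ∈ dualPolyhedron v w from hw0)
  obtain ⟨y, hy, hmax⟩ :=
    exists_max_image (dualVertices v w) (fun y => y p) (finite_dualVertices v w) ⟨z, hz⟩
  let b := dualVertexBasis hw ⟨y, hy⟩
  refine ⟨⟨y, hy⟩, mem_hull_range_basis_iff.2 fun i => ?_⟩
  by_contra! hneg
  -- Moving from `y` along `-b.coord i`, an edge of the dual polyhedron, would increase `y p`.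
  have hup : 0 < (-b.coord i) p := neg_pos.2 hneg
  have hu : ∀ j ∈ tightIndices v w y, (-b.coord i) (v j) ≤ 0 := fun j hj => by
    classical
    rw [LinearMap.neg_apply, neg_nonpos, ← dualVertexBasis_apply hw ⟨y, hy⟩ ⟨j, hj⟩,
      Basis.coord_apply, Basis.repr_self_apply]
    split_ifs <;> simp
  obtain ⟨t, ht, hyt, -⟩ :=
    exists_mem_tightIndices_add_smul hy.1 hu (exists_pos_of_mem_hull hp hup)
  obtain ⟨z, hz, hle⟩ := exists_mem_dualVertices_le_apply hp hgen hyt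
  have hlt : y p < (y + t • -b.coord i) p := lt_add_of_pos_right _ (mul_pos ht hup)
  exact (hlt.trans_le hle).not_ge (hmax z hz)

theorem apply_le_of_mem_hull_dualVertexBasis (hw : IsGenericWeight v w) {y : dualVertices v w}
    {z : Dual 𝕜 V} (hz : z ∈ dualPolyhedron v w) {p : V}
    (hp : p ∈ PointedCone.hull 𝕜 (range (dualVertexBasis hw y))) : z p ≤ y.1 p := by
  refine sub_nonneg.1 <|
    apply_nonneg_of_mem_hull (u := y.1 - z) (forall_mem_range.2 fun i => ?_) hp
  rw [dualVertexBasis_apply]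
  exact sub_nonneg.2 ((hz i).trans (ge_of_eq i.2))

theorem eq_of_mem_hull_dualVertexBasis (hw : IsGenericWeight v w) {y z : dualVertices v w} {p : V}
    (hgen : IsGeneric 𝕜 v p) (hy : p ∈ PointedCone.hull 𝕜 (range (dualVertexBasis hw y)))
    (hz : p ∈ PointedCone.hull 𝕜 (range (dualVertexBasis hw z))) : y = z := by
  let b := dualVertexBasis hw y
  have hyz : y.1 p = z.1 p := le_antisymm
    (apply_le_of_mem_hull_dualVertexBasis hw y.2.1 hz)
    (apply_le_of_mem_hull_dualVertexBasis hw z.2.1 hy)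
  have hcoord_pos (i) : 0 < b.repr p i :=
    (mem_hull_range_basis_iff.1 hy i).lt_of_ne'
      (hgen.repr_ne_zero (fun i => ⟨i.1, (dualVertexBasis_apply hw y i).symm⟩) i)
  have hslack (i) : 0 ≤ (y.1 - z.1) (b i) := by
    rw [dualVertexBasis_apply]
    exact sub_nonneg.2 ((z.2.1 i).trans (ge_of_eq i.2))
  have hsum : (b.repr p).sum (fun i c => c * (y.1 - z.1) (b i)) = 0 := by
    simpa [hyz, Finsupp.linearCombination_apply, map_finsuppSum] using
      congrArg (y.1 - z.1) (b.linearCombination_repr p)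
  refine Subtype.ext (sub_eq_zero.1 (b.ext fun i => ?_))
  have hterm := (Finset.sum_eq_zero_iff_of_nonneg fun i _ =>
    mul_nonneg (hcoord_pos i).le (hslack i)).1 hsum i
      (Finsupp.mem_support_iff.2 (hcoord_pos i).ne')
  exact (mul_eq_zero.1 hterm).resolve_left (hcoord_pos i).ne'

theorem isTriangulation_dualVertexBasis [Finite ι] (hw : IsGenericWeight v w)
    (hw0 : ∀ i, 0 ≤ w i) : IsTriangulation v (dualVertexBasis hw) where
  mem_range y i := ⟨i, (dualVertexBasis_apply hw y i).symm⟩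
  existsUnique_mem_hull _ hp hgen :=
    existsUnique_of_exists_of_unique (exists_mem_hull_dualVertexBasis hw hw0 hp hgen)
      fun _ _ hy hz => eq_of_mem_hull_dualVertexBasis hw hgen hy hz

end Triangulation

section HeightSeries

variable {R V : Type*} [CommRing R] [AddCommGroup V] [Module R V] {ht : Dual R V} {S T : Set V}

/-- The points of `S` at height `t`, where heights are measured by the linear form `ht`. -/
def heightSlice (ht : Dual R V) (S : Set V) (t : ℕ) : Set V :=
  {x ∈ S | ht x = t}

/-- The generating function counting the points of `S` by their height. Points whose height is not
a natural number are ignored, and an infinite slice contributes `0`. -/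
noncomputable def heightSeries (ht : Dual R V) (S : Set V) : PowerSeries ℤ :=
  PowerSeries.mk fun t => ((heightSlice ht S t).ncard : ℤ)

/-- `S` has finitely many points at each height, so that `heightSeries ht S` is meaningful. -/
def HasFiniteSlices (ht : Dual R V) (S : Set V) : Prop :=
  ∀ t, (heightSlice ht S t).Finite

theorem HasFiniteSlices.mono (hT : HasFiniteSlices ht T) (hST : S ⊆ T) : HasFiniteSlices ht S :=
  fun t => (hT t).subset fun _ hx => ⟨hST hx.1, hx.2⟩

theorem coeff_heightSeries (t : ℕ) :
    PowerSeries.coeff t (heightSeries ht S) = (heightSlice ht S t).ncard :=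
  PowerSeries.coeff_mk t _

theorem heightSeries_union (hfin : HasFiniteSlices ht (S ∪ T)) (hdisj : Disjoint S T) :
    heightSeries ht (S ∪ T) = heightSeries ht S + heightSeries ht T := by
  ext t
  have hunion : heightSlice ht (S ∪ T) t = heightSlice ht S t ∪ heightSlice ht T t :=
    Set.ext fun x => or_and_right
  rw [map_add, coeff_heightSeries, coeff_heightSeries, coeff_heightSeries, hunion,
    ncard_union_eq (hdisj.mono (fun _ hx => hx.1) fun _ hx => hx.1)
      (hfin.mono subset_union_left t) (hfin.mono subset_union_right t), Nat.cast_add]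

theorem heightSeries_iUnion {α : Type*} [Fintype α] {S : α → Set V}
    (hfin : HasFiniteSlices ht (⋃ a, S a)) (hdisj : Pairwise (Disjoint on S)) :
    heightSeries ht (⋃ a, S a) = ∑ a, heightSeries ht (S a) := by
  ext t
  have hiUnion : heightSlice ht (⋃ a, S a) t = ⋃ a, heightSlice ht (S a) t := by
    ext x
    simp [heightSlice]
  simp only [map_sum, coeff_heightSeries]
  rw [hiUnion, ncard_iUnion_of_finite (fun a => hfin.mono (subset_iUnion S a) t)
    fun a c hac => (hdisj hac).mono (fun _ hx => hx.1) fun _ hx => hx.1,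
    finsum_eq_sum_of_fintype, Nat.cast_sum]

variable [LinearOrder R] [IsStrictOrderedRing R]

theorem heightSeries_vadd {u : V} {n : ℕ} (hu : ht u = n) (hS : ∀ x ∈ S, 0 ≤ ht x) :
    heightSeries ht (u +ᵥ S) = PowerSeries.X ^ n * heightSeries ht S := by
  ext t
  rw [PowerSeries.coeff_X_pow_mul', coeff_heightSeries]
  split_ifs with hnt
  · have hslice : heightSlice ht (u +ᵥ S) t = u +ᵥ heightSlice ht S (t - n) := by
      ext x
      simp only [heightSlice, mem_ofPred_eq, mem_vadd_set_iff_neg_vadd_mem, vadd_eq_add,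
        neg_add_eq_sub, map_sub, hu, Nat.cast_sub hnt, sub_left_inj]
    rw [coeff_heightSeries, hslice, ncard_vadd_set]
  · have hempty : heightSlice ht (u +ᵥ S) t = ∅ := by
      refine eq_empty_of_forall_notMem ?_
      rintro _ ⟨⟨x, hx, rfl⟩, htx⟩
      have htx : ht u + ht x = t := (map_add ht u x).symm.trans htx
      have hle : (n : R) ≤ t := htx ▸ hu ▸ le_add_of_nonneg_right (hS x hx)
      exact hnt (Nat.cast_le.1 hle)
    rw [hempty, ncard_empty, Nat.cast_zero]

theorem exists_polynomial_heightSeries {u : V} {n : ℕ} (hu : ht u = n)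
    (hS : ∀ x ∈ S, 0 ≤ ht x ∧ ht x ≤ n) :
    ∃ h : ℤ[X], h.natDegree ≤ n ∧ (h : PowerSeries ℤ) = heightSeries ht S ∧
      (h.reflect n : PowerSeries ℤ) = heightSeries ht {x | u - x ∈ S} := by
  have slice_S {t : ℕ} (hnt : n < t) : heightSlice ht S t = ∅ :=
    eq_empty_of_forall_notMem fun x hx =>
      hnt.not_ge (Nat.cast_le.1 (hx.2 ▸ (hS x hx.1).2 : (t : R) ≤ n))
  have slice_sub {t : ℕ} (hnt : n < t) : heightSlice ht {x | u - x ∈ S} t = ∅ := by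
    refine eq_empty_of_forall_notMem fun x hx => hnt.not_ge ((Nat.cast_le (α := R)).1 ?_)
    have hux := (hS _ hx.1).1
    rwa [map_sub, hu, hx.2, sub_nonneg] at hux
  have slice_sub_eq {t : ℕ} (htn : t ≤ n) : heightSlice ht {x | u - x ∈ S} t =
      Equiv.subLeft u ⁻¹' heightSlice ht S (n - t) := by
    ext x
    simp only [heightSlice, mem_preimage, mem_ofPred_eq, Equiv.subLeft_apply, map_sub, hu,
      Nat.cast_sub htn, sub_right_inj]
  refine ⟨(heightSeries ht S).trunc (n + 1), ?_, ?_, ?_⟩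
  · exact Nat.lt_succ_iff.1 (PowerSeries.natDegree_trunc_lt _ n)
  · ext t
    rw [coeff_coe, PowerSeries.coeff_trunc, coeff_heightSeries]
    split_ifs with htn
    · rfl
    · rw [slice_S (by lia), ncard_empty, Nat.cast_zero]
  · ext t
    rw [coeff_coe, coeff_reflect, PowerSeries.coeff_trunc, coeff_heightSeries, coeff_heightSeries]
    rcases le_or_gt t n with htn | hnt
    · rw [revAt_le htn, if_pos (by lia), slice_sub_eq htn,
        ncard_preimage_of_injective_subset_range (Equiv.injective _)
          (by simp [(Equiv.surjective _).range_eq])]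
    · rw [revAt_eq_self_of_lt hnt, if_neg (by lia), slice_sub hnt, ncard_empty, Nat.cast_zero]

end HeightSeries

section HalfOpenBox

variable {𝕜 V κ : Type*} [Field 𝕜] [LinearOrder 𝕜] [AddCommGroup V] [Module 𝕜 V]
  {b : Basis κ 𝕜 V} {L : AddSubgroup V} {ht : Dual 𝕜 V}

/-- The points whose coordinates in the basis `b` are nonnegative, and positive at `N`, and whose
coordinates at `J` moreover lie in `(0, 1]` or `[0, 1)` according to whether the index is in `N`.
For `J = ∅` this is a simplicial cone with the facets indexed by `N` removed; the larger `J`, the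
more of its directions are cut down to a fundamental domain of the translations by `b`. -/
def halfOpenBox (b : Basis κ 𝕜 V) (N : Set κ) (J : Finset κ) : Set V :=
  {x | ∀ i, (0 ≤ b.repr x i ∧ (i ∈ N → b.repr x i ≠ 0)) ∧
    (i ∈ J → b.repr x i ≤ 1 ∧ (i ∉ N → b.repr x i ≠ 1))}

theorem mem_halfOpenBox {N : Set κ} {J : Finset κ} {x : V} :
    x ∈ halfOpenBox b N J ↔ ∀ i, (0 ≤ b.repr x i ∧ (i ∈ N → b.repr x i ≠ 0)) ∧
      (i ∈ J → b.repr x i ≤ 1 ∧ (i ∉ N → b.repr x i ≠ 1)) :=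
  Iff.rfl

variable [IsStrictOrderedRing 𝕜] {N : Set κ} {J : Finset κ}

theorem halfOpenBox_subset_hull :
    halfOpenBox b N J ⊆ PointedCone.hull 𝕜 (range b) :=
  fun _ hx => mem_hull_range_basis_iff.2 fun i => (hx i).1.1

theorem halfOpenBox_eq_union_vadd {j : κ} (hj : j ∉ J) :
    halfOpenBox b N J = halfOpenBox b N (J.cons j hj) ∪ (b j +ᵥ halfOpenBox b N J) := by
  have repr_self (x : V) : b.repr (-b j +ᵥ x) j = b.repr x j - 1 := by
    simp [neg_add_eq_sub]
  have repr_of_ne (x : V) {i : κ} (hij : i ≠ j) : b.repr (-b j +ᵥ x) i = b.repr x i := by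
    simp [hij]
  ext x
  simp only [mem_union, mem_vadd_set_iff_neg_vadd_mem, mem_halfOpenBox]
  refine ⟨fun hx => ?_, ?_⟩
  · by_cases hxj : b.repr x j ≤ 1 ∧ (j ∉ N → b.repr x j ≠ 1)
    · grind
    · right
      intro i
      rcases eq_or_ne i j with rfl | hij
      · rw [repr_self]
        grind
      · grind
  · rintro (hx | hx) i
    · grind
    · rcases eq_or_ne i j with rfl | hij
      · have := hx i
        rw [repr_self] at this
        grind
      · grind

theorem disjoint_halfOpenBox_vadd {j : κ} (hj : j ∉ J) :
    Disjoint (halfOpenBox b N (J.cons j hj)) (b j +ᵥ halfOpenBox b N J) := by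
  rw [disjoint_right]
  rintro _ ⟨x, hx, rfl⟩ hbox
  have hxj := hx j
  have hboxj := (hbox j).2 (Finset.mem_cons_self j J)
  simp only [vadd_eq_add, map_add, b.repr_self, Finsupp.add_apply, Finsupp.single_eq_same] at hboxj
  grind

theorem one_sub_X_mul_heightSeries_halfOpenBox (hb : ∀ i, ht (b i) = 1) (hbL : ∀ i, b i ∈ L)
    (hfin : HasFiniteSlices ht (L ∩ PointedCone.hull 𝕜 (range b))) {j : κ} (hj : j ∉ J) :
    (1 - PowerSeries.X) * heightSeries ht (L ∩ halfOpenBox b N J) =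
      heightSeries ht (L ∩ halfOpenBox b N (J.cons j hj)) := by
  have hnonneg : ∀ x ∈ (L : Set V) ∩ halfOpenBox b N J, 0 ≤ ht x := fun x hx =>
    apply_nonneg_of_mem_hull (forall_mem_range.2 fun i => hb i ▸ zero_le_one)
      (halfOpenBox_subset_hull hx.2)
  have hsplit : (L : Set V) ∩ halfOpenBox b N J =
      ((L : Set V) ∩ halfOpenBox b N (J.cons j hj)) ∪
        (b j +ᵥ ((L : Set V) ∩ halfOpenBox b N J)) := by
    rw [vadd_set_inter, vadd_coe_set (hbL j), ← inter_union_distrib_left,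
      ← halfOpenBox_eq_union_vadd hj]
  have hdisj : Disjoint ((L : Set V) ∩ halfOpenBox b N (J.cons j hj))
      (b j +ᵥ ((L : Set V) ∩ halfOpenBox b N J)) :=
    (disjoint_halfOpenBox_vadd hj).mono inter_subset_right (vadd_set_mono inter_subset_right)
  have hfin' : HasFiniteSlices ht (L ∩ halfOpenBox b N J) :=
    hfin.mono (inter_subset_inter_right _ halfOpenBox_subset_hull)
  rw [hsplit] at hfin'
  have hseries := heightSeries_union hfin' hdisj
  rw [← hsplit, heightSeries_vadd (n := 1) (by simp [hb]) hnonneg, pow_one] at hseries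
  rw [sub_mul, one_mul, sub_eq_iff_eq_add]
  exact hseries

theorem one_sub_X_pow_mul_heightSeries_halfOpenBox (hb : ∀ i, ht (b i) = 1)
    (hbL : ∀ i, b i ∈ L) (hfin : HasFiniteSlices ht (L ∩ PointedCone.hull 𝕜 (range b)))
    (N : Set κ) (J : Finset κ) :
    (1 - PowerSeries.X) ^ J.card * heightSeries ht (L ∩ halfOpenBox b N ∅) =
      heightSeries ht (L ∩ halfOpenBox b N J) := by
  induction J using Finset.cons_induction with
  | empty => rw [Finset.card_empty, pow_zero, one_mul]
  | cons j J hj ih =>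
    rw [Finset.card_cons, pow_succ', mul_assoc, ih,
      one_sub_X_mul_heightSeries_halfOpenBox hb hbL hfin]

variable [Fintype κ]

theorem sum_sub_mem_halfOpenBox_univ_iff {x : V} :
    ∑ i, b i - x ∈ halfOpenBox b N Finset.univ ↔ x ∈ halfOpenBox b Nᶜ Finset.univ := by
  have hrepr (i : κ) : b.repr (∑ j, b j - x) i = 1 - b.repr x i := by
    simp
  simp only [mem_halfOpenBox, hrepr, Finset.mem_univ, true_imp_iff, mem_compl_iff]
  grind

theorem exists_polynomial_halfOpenBox (hb : ∀ i, ht (b i) = 1) (hbL : ∀ i, b i ∈ L)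
    (hfin : HasFiniteSlices ht (L ∩ PointedCone.hull 𝕜 (range b))) (N : Set κ) :
    ∃ h : ℤ[X], h.natDegree ≤ Fintype.card κ ∧
      (h : PowerSeries ℤ) = (1 - PowerSeries.X) ^ Fintype.card κ *
        heightSeries ht (L ∩ halfOpenBox b N ∅) ∧
      (h.reflect (Fintype.card κ) : PowerSeries ℤ) = (1 - PowerSeries.X) ^ Fintype.card κ *
        heightSeries ht (L ∩ halfOpenBox b Nᶜ ∅) := by
  have hsum : ht (∑ i, b i) = Fintype.card κ := by simp [hb]
  have hnonneg {N : Set κ} {x : V} (hx : x ∈ halfOpenBox b N Finset.univ) : 0 ≤ ht x :=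
    apply_nonneg_of_mem_hull (forall_mem_range.2 fun i => hb i ▸ zero_le_one)
      (halfOpenBox_subset_hull hx)
  have hle : ∀ x ∈ (L : Set V) ∩ halfOpenBox b N Finset.univ, 0 ≤ ht x ∧ ht x ≤ Fintype.card κ := by
    refine fun x hx => ⟨hnonneg hx.2, ?_⟩
    rw [← hsum, ← sub_nonneg, ← map_sub]
    refine hnonneg (N := Nᶜ) (sum_sub_mem_halfOpenBox_univ_iff.1 ?_)
    rw [sub_sub_cancel]
    exact hx.2
  obtain ⟨h, hdeg, hcoe, hreflect⟩ := exists_polynomial_heightSeries hsum hle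
  have hsub_mem (x : V) : ∑ i, b i - x ∈ L ↔ x ∈ L := by
    rw [sub_eq_add_neg, add_mem_cancel_left (sum_mem fun i _ => hbL i), neg_mem_iff]
  have hsub : {x | ∑ i, b i - x ∈ (L : Set V) ∩ halfOpenBox b N Finset.univ} =
      (L : Set V) ∩ halfOpenBox b Nᶜ Finset.univ :=
    Set.ext fun x => and_congr (hsub_mem x) sum_sub_mem_halfOpenBox_univ_iff
  have hbox := one_sub_X_pow_mul_heightSeries_halfOpenBox hb hbL hfin
  rw [hsub, ← hbox, Finset.card_univ] at hreflect
  rw [← hbox, Finset.card_univ] at hcoe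
  exact ⟨h, hdeg, hcoe, hreflect⟩

end HalfOpenBox

section HalfOpenCone

variable {𝕜 V : Type*} [Field 𝕜] [LinearOrder 𝕜] [IsStrictOrderedRing 𝕜]
  [AddCommGroup V] [Module 𝕜 V]

theorem smul_mem_interior [TopologicalSpace V] [ContinuousConstSMul 𝕜 V] {C : PointedCone 𝕜 V}
    {q : V} (hq : q ∈ interior (C : Set V)) {ε : 𝕜} (hε : 0 < ε) :
    ε • q ∈ interior (C : Set V) := by
  refine interior_mono ?_ (interior_smul₀ hε.ne' (C : Set V) ▸ smul_mem_smul_set hq)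
  rintro _ ⟨x, hx, rfl⟩
  exact C.smul_mem hε.le hx

theorem add_mem_interior [TopologicalSpace V] [IsTopologicalAddGroup V] {C : PointedCone 𝕜 V}
    {x y : V} (hx : x ∈ C) (hy : y ∈ interior (C : Set V)) : x + y ∈ interior (C : Set V) :=
  interior_mono (add_subset_iff.2 fun _ ha _ hc => C.add_mem ha hc) <|
    subset_interior_add_right (add_mem_add hx hy)

variable [TopologicalSpace 𝕜]

/-- The points from which one enters the cone `C` immediately when moving in the direction `q`.
For generic `q` this is `C` with those boundary points removed at which `q` points outwards. -/
def halfOpenCone (C : PointedCone 𝕜 V) (q : V) : Set V :=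
  {x | ∀ᶠ ε in 𝓝[>] (0 : 𝕜), x + ε • q ∈ C}

theorem subset_halfOpenCone {C : PointedCone 𝕜 V} {q : V} (hq : q ∈ C) :
    (C : Set V) ⊆ halfOpenCone C q := fun x hx => by
  filter_upwards [self_mem_nhdsWithin] with ε (hε : 0 < ε)
  exact C.add_mem hx (C.smul_mem hε.le hq)

theorem interior_subset_halfOpenCone [TopologicalSpace V] [ContinuousAdd V] [ContinuousSMul 𝕜 V]
    (C : PointedCone 𝕜 V) (q : V) : interior (C : Set V) ⊆ halfOpenCone C q := fun x hx =>
  (tendsto_add_smul_nhdsGT_zero x q).eventually (mem_interior_iff_mem_nhds.1 hx)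

variable [OrderTopology 𝕜]

theorem halfOpenCone_neg_subset_interior [TopologicalSpace V] [IsTopologicalAddGroup V]
    [ContinuousConstSMul 𝕜 V] {C : PointedCone 𝕜 V} {q : V} (hq : q ∈ interior (C : Set V)) :
    halfOpenCone C (-q) ⊆ interior (C : Set V) := by
  intro x (hx : ∀ᶠ ε in 𝓝[>] (0 : 𝕜), x + ε • -q ∈ C)
  obtain ⟨ε, hxε, hε⟩ := (hx.and self_mem_nhdsWithin).exists
  have hinterior := add_mem_interior hxε (smul_mem_interior hq (mem_Ioi.1 hε))
  rwa [smul_neg, neg_add_cancel_right] at hinterior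

theorem eventually_nonneg_add_mul_iff (a c : 𝕜) :
    ∀ᶠ ε in 𝓝[>] (0 : 𝕜), (0 ≤ a + ε * c ↔ 0 ≤ a ∧ (c < 0 → a ≠ 0)) := by
  have hlim := tendsto_add_smul_nhdsGT_zero (𝕜 := 𝕜) a c
  rcases lt_trichotomy a 0 with ha | rfl | ha
  · filter_upwards [hlim (gt_mem_nhds ha)] with ε hε
    exact iff_of_false (not_le.2 hε) fun h => ha.not_ge h.1
  · filter_upwards [self_mem_nhdsWithin] with ε hε
    simp [mul_nonneg_iff_of_pos_left (mem_Ioi.1 hε)]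
  · filter_upwards [hlim (lt_mem_nhds ha)] with ε hε
    exact iff_of_true hε.le ⟨ha.le, fun _ => ha.ne'⟩

theorem eventually_add_smul_mem_hull_range_iff {κ : Type*} [Finite κ] (b : Basis κ 𝕜 V)
    (q x : V) :
    ∀ᶠ ε in 𝓝[>] (0 : 𝕜), (x + ε • q ∈ PointedCone.hull 𝕜 (range b) ↔
      x ∈ halfOpenBox b {i | b.repr q i < 0} ∅) := by
  filter_upwards [eventually_all.2 fun i => eventually_nonneg_add_mul_iff (b.repr x i) (b.repr q i)]
    with ε hε
  simp [mem_hull_range_basis_iff, mem_halfOpenBox, hε]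

namespace IsTriangulation

variable {α ι : Type*} {κ : α → Type*} {v : ι → V} {b : ∀ a, Basis (κ a) 𝕜 V} [Finite ι]
  [∀ a, Finite (κ a)] {q : V}

theorem halfOpenCone_eq_iUnion [Finite α] (hT : IsTriangulation v b) (hq : IsGeneric 𝕜 v q) :
    halfOpenCone (PointedCone.hull 𝕜 (range v)) q =
      ⋃ a, halfOpenBox (b a) {i | (b a).repr q i < 0} ∅ := by
  ext x
  have hcell (a : α) := eventually_add_smul_mem_hull_range_iff (b a) q x
  rw [mem_iUnion]
  constructor
  · intro (hx : ∀ᶠ ε in 𝓝[>] (0 : 𝕜), x + ε • q ∈ _)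
    obtain ⟨ε, ⟨hε, hgen⟩, hcell⟩ :=
      ((hx.and (hq.eventually_add_smul x)).and (eventually_all.2 hcell)).exists
    obtain ⟨a, ha, -⟩ := hT.existsUnique_mem_hull _ hε hgen
    exact ⟨a, (hcell a).1 ha⟩
  · rintro ⟨a, ha⟩
    filter_upwards [hcell a] with ε hε
    exact hT.hull_range_basis_le a (hε.2 ha)

theorem pairwise_disjoint_halfOpenBox (hT : IsTriangulation v b) (hq : IsGeneric 𝕜 v q) :
    Pairwise (Disjoint on fun a => halfOpenBox (b a) {i | (b a).repr q i < 0} ∅) := by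
  refine fun a c hac => disjoint_left.2 fun x ha hc => hac ?_
  have hcell (a : α) := eventually_add_smul_mem_hull_range_iff (b a) q x
  obtain ⟨ε, ⟨hεa, hεc⟩, hgen⟩ :=
    (((hcell a).and (hcell c)).and (hq.eventually_add_smul x)).exists
  have hmem := hεa.2 ha
  exact (hT.existsUnique_mem_hull _ (hT.hull_range_basis_le a hmem) hgen).unique hmem (hεc.2 hc)

theorem halfOpenCone_subset [Finite α] (hT : IsTriangulation v b) (hq : IsGeneric 𝕜 v q) :
    halfOpenCone (PointedCone.hull 𝕜 (range v)) q ⊆ PointedCone.hull 𝕜 (range v) := by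
  rw [hT.halfOpenCone_eq_iUnion hq]
  exact iUnion_subset fun a => halfOpenBox_subset_hull.trans (hT.hull_range_basis_le a)

theorem heightSeries_halfOpenCone [Fintype α] {L : AddSubgroup V} {ht : Dual 𝕜 V}
    (hT : IsTriangulation v b) (hq : IsGeneric 𝕜 v q)
    (hfin : HasFiniteSlices ht (L ∩ PointedCone.hull 𝕜 (range v))) :
    heightSeries ht (L ∩ halfOpenCone (PointedCone.hull 𝕜 (range v)) q) =
      ∑ a, heightSeries ht (L ∩ halfOpenBox (b a) {i | (b a).repr q i < 0} ∅) := by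
  have hfin' := hfin.mono (inter_subset_inter_right L (hT.halfOpenCone_subset hq))
  rw [hT.halfOpenCone_eq_iUnion hq, inter_iUnion] at hfin' ⊢
  exact heightSeries_iUnion hfin' fun a c hac =>
    (hT.pairwise_disjoint_halfOpenBox hq hac).mono inter_subset_right inter_subset_right

end IsTriangulation

end HalfOpenCone

section Reciprocity

theorem reflect_sum {R α : Type*} [Semiring R] (n : ℕ) (s : Finset α) (f : α → R[X]) :
    (∑ a ∈ s, f a).reflect n = ∑ a ∈ s, (f a).reflect n :=
  map_sum ({ toFun := reflect n, map_zero' := reflect_zero, map_add' := (reflect_add · · n) } :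
    R[X] →+ R[X]) f s

variable {𝕜 V ι : Type*} [Field 𝕜] [LinearOrder 𝕜] [IsStrictOrderedRing 𝕜] [TopologicalSpace 𝕜]
  [OrderTopology 𝕜] [AddCommGroup V] [Module 𝕜 V] [Finite ι] {v : ι → V} {L : AddSubgroup V}
  {ht : Dual 𝕜 V}

theorem IsTriangulation.exists_polynomial_halfOpenCone {α : Type*} {κ : α → Type*} [Finite α]
    [∀ a, Finite (κ a)] {b : ∀ a, Basis (κ a) 𝕜 V} (hT : IsTriangulation v b)
    (hv : ∀ i, ht (v i) = 1) (hvL : ∀ i, v i ∈ L)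
    (hfin : HasFiniteSlices ht (L ∩ PointedCone.hull 𝕜 (range v))) {q : V}
    (hq : IsGeneric 𝕜 v q) :
    ∃ h : ℤ[X], h.natDegree ≤ finrank 𝕜 V ∧
      (h : PowerSeries ℤ) = (1 - PowerSeries.X) ^ finrank 𝕜 V *
        heightSeries ht (L ∩ halfOpenCone (PointedCone.hull 𝕜 (range v)) q) ∧
      (h.reflect (finrank 𝕜 V) : PowerSeries ℤ) = (1 - PowerSeries.X) ^ finrank 𝕜 V *
        heightSeries ht (L ∩ halfOpenCone (PointedCone.hull 𝕜 (range v)) (-q)) := by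
  have := Fintype.ofFinite α
  have (a : α) := Fintype.ofFinite (κ a)
  have hht (a i) : ht (b a i) = 1 := by
    obtain ⟨j, hj⟩ := hT.mem_range a i
    rw [← hj, hv]
  have hL (a i) : b a i ∈ L := by
    obtain ⟨j, hj⟩ := hT.mem_range a i
    exact hj ▸ hvL j
  choose h hdeg hcoe hreflect using fun a => exists_polynomial_halfOpenBox (hht a) (hL a)
    (hfin.mono (inter_subset_inter_right _ (hT.hull_range_basis_le a)))
    {i | (b a).repr q i < 0}
  have hcompl (a : α) : {i | (b a).repr q i < 0}ᶜ = {i | (b a).repr (-q) i < 0} := by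
    ext i
    simpa using (hq.repr_ne_zero (hT.mem_range a) i).symm.le_iff_lt
  simp only [hcompl, ← finrank_eq_card_basis (b _)] at hdeg hcoe hreflect
  refine ⟨∑ a, h a, natDegree_sum_le_of_forall_le _ _ fun a _ => hdeg a, ?_, ?_⟩
  · rw [hT.heightSeries_halfOpenCone hq hfin, Finset.mul_sum, ← coeToPowerSeries.ringHom_apply,
      map_sum]
    exact Finset.sum_congr rfl fun a _ => hcoe a
  · rw [hT.heightSeries_halfOpenCone hq.neg hfin, Finset.mul_sum, reflect_sum,
      ← coeToPowerSeries.ringHom_apply, map_sum]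
    exact Finset.sum_congr rfl fun a _ => hreflect a

variable [TopologicalSpace V] [IsTopologicalAddGroup V] [ContinuousSMul 𝕜 V]

theorem ehrhart_macdonald_reciprocity (hv : ∀ i, ht (v i) = 1) (hvL : ∀ i, v i ∈ L)
    (hfin : HasFiniteSlices ht (L ∩ PointedCone.hull 𝕜 (range v)))
    (hint : (interior (PointedCone.hull 𝕜 (range v) : Set V)).Nonempty) :
    ∃ h : ℤ[X], h.natDegree ≤ finrank 𝕜 V ∧
      (h : PowerSeries ℤ) = (1 - PowerSeries.X) ^ finrank 𝕜 V *
        heightSeries ht (L ∩ PointedCone.hull 𝕜 (range v)) ∧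
      (h.reflect (finrank 𝕜 V) : PowerSeries ℤ) = (1 - PowerSeries.X) ^ finrank 𝕜 V *
        heightSeries ht (L ∩ interior (PointedCone.hull 𝕜 (range v) : Set V)) := by
  obtain ⟨q, hq, hgen⟩ := exists_isGeneric_mem (𝕜 := 𝕜) v isOpen_interior hint
  obtain ⟨w, hw_pos, hw⟩ := exists_isGenericWeight_pos (𝕜 := 𝕜) v
  have := (finite_dualVertices v w).to_subtype
  have hT := isTriangulation_dualVertexBasis hw fun i => (hw_pos i).le
  have hcone : halfOpenCone (PointedCone.hull 𝕜 (range v)) q = PointedCone.hull 𝕜 (range v) :=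
    (hT.halfOpenCone_subset hgen).antisymm (subset_halfOpenCone (interior_subset hq))
  have hinterior : halfOpenCone (PointedCone.hull 𝕜 (range v)) (-q) =
      interior (PointedCone.hull 𝕜 (range v) : Set V) :=
    (halfOpenCone_neg_subset_interior hq).antisymm (interior_subset_halfOpenCone _ _)
  have hpoly := hT.exists_polynomial_halfOpenCone hv hvL hfin hgen
  rwa [hcone, hinterior] at hpoly

end Reciprocity

theorem natDegree_eq_and_reverse_eq_of_reflect_eq {R : Type*} [Semiring R] {h : R[X]} {n k : ℕ}
    (h0 : h.coeff 0 ≠ 0) (hdeg : h.natDegree ≤ n) (hreflect : h.reflect n = X ^ k * h) :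
    n = k + h.natDegree ∧ h.reverse = h := by
  have : Nontrivial R := ⟨_, _, h0⟩
  have h_ne : h ≠ 0 := fun h_eq => h0 (by rw [h_eq, coeff_zero])
  have hn : (h.reflect n).natDegree = n := by
    refine natDegree_eq_of_le_of_coeff_ne_zero ((natDegree_reflect_le).trans (by simp [hdeg])) ?_
    rwa [coeff_reflect, revAt_le le_rfl, Nat.sub_self]
  have hnk : n = k + h.natDegree := by
    rw [← hn, hreflect, X_pow_mul, natDegree_mul_X_pow k h_ne, add_comm]
  refine ⟨hnk, ?_⟩
  have hmul := reflect_mul (1 : R[X]) h (F := k) (by simp) le_rfl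
  rw [one_mul, reflect_one, ← hnk, hreflect] at hmul
  exact ((isRegular_X_pow k).left hmul).symm

section Homogenization

variable {m d : ℕ} {M : Matrix (Fin m) (Fin d) ℤ}

/-- The cone over `positivePolyhedron M × {1}`, with the height as last coordinate. -/
def homogenizedCone (M : Matrix (Fin m) (Fin d) ℤ) : PointedCone ℝ ((Fin d → ℝ) × ℝ) where
  carrier := {p | (∀ j, 0 ≤ p.1 j) ∧ ∀ i, ∑ j, (M i j : ℝ) * p.1 j ≤ p.2}
  zero_mem' := ⟨fun _ => le_rfl, fun i => by simp⟩
  add_mem' {p q} hp hq := by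
    refine ⟨fun j => add_nonneg (hp.1 j) (hq.1 j), fun i => ?_⟩
    simp only [Prod.fst_add, Prod.snd_add, Pi.add_apply, mul_add, Finset.sum_add_distrib]
    exact add_le_add (hp.2 i) (hq.2 i)
  smul_mem' r p hp := by
    refine ⟨fun j => mul_nonneg r.2 (hp.1 j), fun i => ?_⟩
    have hle := mul_le_mul_of_nonneg_left (hp.2 i) r.2
    simp only [Finset.mul_sum, mul_left_comm (r : ℝ)] at hle
    exact hle

/-- The points of `ℝᵈ × ℝ` with integer coordinates. -/
def integerLattice (d : ℕ) : AddSubgroup ((Fin d → ℝ) × ℝ) :=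
  (((Int.castAddHom ℝ).compLeft (Fin d)).prodMap (Int.castAddHom ℝ)).range

theorem mem_integerLattice {p : (Fin d → ℝ) × ℝ} :
    p ∈ integerLattice d ↔ ∃ (z : Fin d → ℤ) (t : ℤ), ((fun j => (z j : ℝ)), (t : ℝ)) = p :=
  Prod.exists

theorem mem_homogenizedCone {p : (Fin d → ℝ) × ℝ} :
    p ∈ homogenizedCone M ↔ (∀ j, 0 ≤ p.1 j) ∧ ∀ i, ∑ j, (M i j : ℝ) * p.1 j ≤ p.2 :=
  Iff.rfl

theorem inv_smul_mem_positivePolyhedron {p : (Fin d → ℝ) × ℝ} (hp : p ∈ homogenizedCone M) {r : ℝ}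
    (hr : 0 < r) (hpr : p.2 ≤ r) : r⁻¹ • p.1 ∈ positivePolyhedron M := by
  have hmem := (homogenizedCone M).smul_mem (inv_nonneg.2 hr.le) hp
  refine ⟨hmem.1, fun i => (hmem.2 i).trans ?_⟩
  rwa [Prod.smul_snd, smul_eq_mul, inv_mul_le_iff₀ hr, mul_one]

theorem smul_mk_one_mem_homogenizedCone {x : Fin d → ℝ} (hx : x ∈ positivePolyhedron M) {r : ℝ}
    (hr : 0 ≤ r) : (r • x, r) ∈ homogenizedCone M := by
  have hx1 : ((x, 1) : (Fin d → ℝ) × ℝ) ∈ homogenizedCone M := hx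
  simpa using (homogenizedCone M).smul_mem hr hx1

theorem heightSlice_homogenizedCone {t : ℕ} (ht : t ≠ 0) :
    heightSlice (LinearMap.snd ℝ (Fin d → ℝ) ℝ) (integerLattice d ∩ homogenizedCone M) t =
      (fun z : Fin d → ℤ => ((fun j => (z j : ℝ)), (t : ℝ))) ''
        {z | (fun j => (z j : ℝ)) ∈ (t : ℝ) • positivePolyhedron M} := by
  have htpos : (0 : ℝ) < t := Nat.cast_pos.2 (Nat.pos_of_ne_zero ht)
  ext x
  constructor
  · rintro ⟨⟨hx, hC⟩, hxt⟩
    obtain ⟨z, s, rfl⟩ := mem_integerLattice.1 hx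
    obtain rfl : s = t := Int.cast_injective (α := ℝ) (by simpa using hxt)
    refine ⟨z, (mem_smul_set_iff_inv_smul_mem₀ htpos.ne' _ _).2 ?_, by simp⟩
    exact inv_smul_mem_positivePolyhedron hC htpos (by simp)
  · rintro ⟨z, ⟨x, hx, hxz⟩, rfl⟩
    refine ⟨⟨mem_integerLattice.2 ⟨z, t, by simp⟩, ?_⟩, rfl⟩
    dsimp only at hxz ⊢
    exact hxz ▸ smul_mk_one_mem_homogenizedCone hx htpos.le

section Bounded

variable (hbdd : Bornology.IsBounded (positivePolyhedron M))
include hbdd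

theorem fst_eq_zero_of_mem_homogenizedCone {p : (Fin d → ℝ) × ℝ} (hp : p ∈ homogenizedCone M)
    (hp2 : p.2 ≤ 0) : p.1 = 0 := by
  obtain ⟨R, hR⟩ := hbdd.exists_norm_le
  by_contra hne
  obtain ⟨n, hn⟩ := Archimedean.arch (R + 1) (norm_pos_iff.2 hne)
  have hmem : n • p.1 ∈ positivePolyhedron M := by
    have hnp := (homogenizedCone M).nsmul_mem hp n
    exact ⟨hnp.1, fun i => (hnp.2 i).trans ((nsmul_nonpos hp2 n).trans zero_le_one)⟩
  have hnorm := hR _ hmem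
  rw [← Nat.cast_smul_eq_nsmul ℝ, norm_smul, Real.norm_natCast] at hnorm
  rw [nsmul_eq_mul] at hn
  linarith

theorem snd_nonneg_of_mem_homogenizedCone (hm : 0 < m) {p : (Fin d → ℝ) × ℝ}
    (hp : p ∈ homogenizedCone M) : 0 ≤ p.2 := by
  by_contra! hneg
  have hrow := hp.2 ⟨0, hm⟩
  simp only [fst_eq_zero_of_mem_homogenizedCone hbdd hp hneg.le, Pi.zero_apply, mul_zero,
    Finset.sum_const_zero] at hrow
  exact hneg.not_ge hrow

theorem rowSum_nonneg (hm : 0 < m) {s : ℤ} (hs : ∀ i, ∑ j, M i j = s) : 0 ≤ s := by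
  have hmem : ((1, s) : (Fin d → ℝ) × ℝ) ∈ homogenizedCone M :=
    ⟨fun _ => zero_le_one, fun i => by simp [← hs i]⟩
  exact Int.cast_nonneg_iff.1 (snd_nonneg_of_mem_homogenizedCone hbdd hm hmem)

theorem hull_range_eq_homogenizedCone (hm : 0 < m) {ι : Type*} {u : ι → Fin d → ℝ}
    (hu : positivePolyhedron M = convexHull ℝ (range u)) :
    PointedCone.hull ℝ (range fun i => (u i, (1 : ℝ))) = homogenizedCone M := by
  set C := PointedCone.hull ℝ (range fun i => (u i, (1 : ℝ)))
  have hconvex : Convex ℝ {x : Fin d → ℝ | (x, (1 : ℝ)) ∈ C} := fun x hx y hy a c ha hc hac => by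
    simpa [hac] using C.add_mem (C.smul_mem ha hx) (C.smul_mem hc hy)
  have hslice : ∀ x ∈ positivePolyhedron M, (x, (1 : ℝ)) ∈ C := by
    rw [hu]
    exact convexHull_min (range_subset_iff.2 fun i => PointedCone.subset_hull ⟨i, rfl⟩) hconvex
  apply le_antisymm
  · refine Submodule.span_le.2 (range_subset_iff.2 fun i => ?_)
    have hui : u i ∈ positivePolyhedron M := hu ▸ subset_convexHull ℝ _ (mem_range_self i)
    exact hui
  · intro p hp
    rcases (snd_nonneg_of_mem_homogenizedCone hbdd hm hp).eq_or_lt with h0 | hpos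
    · rw [show p = 0 from Prod.ext (fst_eq_zero_of_mem_homogenizedCone hbdd hp h0.ge) h0.symm]
      exact C.zero_mem
    · have hmem := C.smul_mem hpos.le (hslice _ (inv_smul_mem_positivePolyhedron hp hpos le_rfl))
      rwa [Prod.smul_mk, smul_inv_smul₀ hpos.ne', smul_eq_mul, mul_one] at hmem

theorem hasFiniteSlices_homogenizedCone :
    HasFiniteSlices (LinearMap.snd ℝ (Fin d → ℝ) ℝ) (integerLattice d ∩ homogenizedCone M) := by
  intro t
  obtain ⟨R, hR⟩ := hbdd.exists_norm_le
  refine ((finite_Icc (0 : Fin d → ℤ) fun _ => ⌊(t + 1) * R⌋).image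
    fun z => ((fun j => (z j : ℝ)), (t : ℝ))).subset ?_
  rintro x ⟨⟨hx, hC⟩, hxt⟩
  obtain ⟨z, s, rfl⟩ := mem_integerLattice.1 hx
  obtain rfl : s = t := Int.cast_injective (α := ℝ) (by simpa using hxt)
  refine ⟨z, ⟨fun j => Int.cast_nonneg_iff.1 (hC.1 j), fun j => Int.le_floor.2 ?_⟩, by simp⟩
  have hpos : (0 : ℝ) < t + 1 := by positivity
  have hle := (norm_le_pi_norm _ j).trans
    (hR _ (inv_smul_mem_positivePolyhedron hC hpos (by simp)))
  rw [Pi.smul_apply, norm_smul, norm_inv, Real.norm_of_nonneg hpos.le, inv_mul_le_iff₀ hpos] at hle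
  exact (le_abs_self _).trans hle

theorem heightSlice_homogenizedCone_zero :
    heightSlice (LinearMap.snd ℝ (Fin d → ℝ) ℝ) (integerLattice d ∩ homogenizedCone M) 0 = {0} := by
  refine Subset.antisymm ?_ (singleton_subset_iff.2 ⟨⟨zero_mem _, zero_mem _⟩, by simp⟩)
  rintro x ⟨⟨-, hC⟩, hx⟩
  have hx2 : x.2 = 0 := by simpa using hx
  exact Prod.ext (fst_eq_zero_of_mem_homogenizedCone hbdd hC hx2.le) hx2

theorem heightSeries_homogenizedCone :
    heightSeries (LinearMap.snd ℝ (Fin d → ℝ) ℝ) (integerLattice d ∩ homogenizedCone M) =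
      ehrhartSeries (positivePolyhedron M) := by
  ext t
  rw [coeff_heightSeries, ehrhartSeries, PowerSeries.coeff_mk]
  split_ifs with ht
  · rw [ht, heightSlice_homogenizedCone_zero hbdd, ncard_singleton, Nat.cast_one]
  · rw [heightSlice_homogenizedCone ht, ncard_image_of_injective, latticeCount]
    intro y z hyz
    simpa [funext_iff] using hyz

end Bounded

theorem interior_homogenizedCone : interior (homogenizedCone M : Set ((Fin d → ℝ) × ℝ)) =
    {p | (∀ j, 0 < p.1 j) ∧ ∀ i, ∑ j, (M i j : ℝ) * p.1 j < p.2} := by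
  refine Subset.antisymm (fun p hp => ?_) (interior_maximal ?_ ?_)
  · have exists_mem (q : (Fin d → ℝ) × ℝ) : ∃ ε : ℝ, p + ε • q ∈ homogenizedCone M ∧ 0 < ε := by
      have hmem : ∀ᶠ ε in 𝓝[>] (0 : ℝ), p + ε • q ∈ homogenizedCone M :=
        interior_subset_halfOpenCone _ q hp
      exact (hmem.and self_mem_nhdsWithin).exists
    refine ⟨fun j => ?_, fun i => ?_⟩
    · obtain ⟨ε, hmem, hε⟩ := exists_mem (-1, 0)
      have hj : 0 ≤ p.1 j + ε * -1 := hmem.1 j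
      linarith
    · obtain ⟨ε, hmem, hε⟩ := exists_mem (0, -1)
      have hi : ∑ j, (M i j : ℝ) * (p.1 j + ε * 0) ≤ p.2 + ε * -1 := hmem.2 i
      simp only [mul_zero, add_zero] at hi
      linarith
  · exact fun p hp => ⟨fun j => (hp.1 j).le, fun i => (hp.2 i).le⟩
  · simp only [ofPred_and, ofPred_forall]
    refine (isOpen_iInter_of_finite fun j => ?_).inter (isOpen_iInter_of_finite fun i => ?_) <;>
      exact isOpen_lt (by fun_prop) (by fun_prop)

theorem integerLattice_inter_interior_homogenizedCone {k : ℤ} (hk : ∀ i, k = ∑ j, M i j + 1) :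
    (integerLattice d : Set ((Fin d → ℝ) × ℝ)) ∩ interior (homogenizedCone M) =
      ((1, k) : (Fin d → ℝ) × ℝ) +ᵥ
        ((integerLattice d : Set ((Fin d → ℝ) × ℝ)) ∩ homogenizedCone M) := by
  have hmem : ((1, k) : (Fin d → ℝ) × ℝ) ∈ integerLattice d :=
    mem_integerLattice.2 ⟨1, k, by ext <;> simp⟩
  rw [vadd_set_inter, vadd_coe_set hmem, interior_homogenizedCone]
  ext x
  refine and_congr_right fun hx => ?_
  obtain ⟨z, s, rfl⟩ := mem_integerLattice.1 hx
  rw [mem_vadd_set_iff_neg_vadd_mem, SetLike.mem_coe, mem_homogenizedCone]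
  simp only [vadd_eq_add, neg_add_eq_sub, Prod.fst_sub, Prod.snd_sub, Pi.sub_apply, Pi.one_apply,
    mul_sub_one, Finset.sum_sub_distrib, mem_ofPred_eq, sub_nonneg]
  refine and_congr (forall_congr' fun j => ?_) (forall_congr' fun i => ?_)
  · norm_cast
  · rw [hk i]
    norm_cast
    rw [← Int.add_one_le_iff]
    constructor <;> intro h <;> linarith

theorem IsIntegralPolytope.isBounded {P : Set (Fin d → ℝ)} (hP : IsIntegralPolytope P) :
    Bornology.IsBounded P := by
  obtain ⟨V, rfl⟩ := hP
  exact isBounded_convexHull.2 (V.finite_toSet.image _).isBounded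

theorem exists_polynomial_ehrhartSeries (hm : 0 < m)
    (hM : IsIntegralPolytope (positivePolyhedron M)) {k : ℕ} (hk : ∀ i, (k : ℤ) = ∑ j, M i j + 1) :
    ∃ h : ℤ[X], h.natDegree ≤ d + 1 ∧ IsHStarPolynomial (positivePolyhedron M) h ∧
      h.reflect (d + 1) = X ^ k * h := by
  have hbdd := hM.isBounded
  obtain ⟨V, hV⟩ := hM
  rw [image_eq_range] at hV
  have hhull := hull_range_eq_homogenizedCone hbdd hm hV
  have hint : (interior (homogenizedCone M : Set ((Fin d → ℝ) × ℝ))).Nonempty := by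
    refine ⟨(1, k), ?_⟩
    rw [interior_homogenizedCone]
    refine ⟨fun _ => zero_lt_one, fun i => ?_⟩
    have hrow : (k : ℝ) = ∑ j, (M i j : ℝ) + 1 := mod_cast hk i
    simp [hrow]
  obtain ⟨h, hdeg, hcoe, hreflect⟩ := ehrhart_macdonald_reciprocity
    (v := fun z : (V : Set (Fin d → ℤ)) => ((fun j => (z.1 j : ℝ)), (1 : ℝ)))
    (L := integerLattice d) (ht := LinearMap.snd ℝ (Fin d → ℝ) ℝ) (fun _ => rfl)
    (fun z => mem_integerLattice.2 ⟨z, 1, by simp⟩)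
    (hhull ▸ hasFiniteSlices_homogenizedCone hbdd) (hhull ▸ hint)
  have hfinrank : finrank ℝ ((Fin d → ℝ) × ℝ) = d + 1 := by simp
  rw [hfinrank] at hdeg hcoe hreflect
  rw [hhull, heightSeries_homogenizedCone hbdd] at hcoe
  refine ⟨h, hdeg, hcoe, Polynomial.coe_inj.1 ?_⟩
  rw [hreflect, hhull, integerLattice_inter_interior_homogenizedCone hk,
    heightSeries_vadd (n := k) (by simp) fun x hx => snd_nonneg_of_mem_homogenizedCone hbdd hm hx.2,
    heightSeries_homogenizedCone hbdd, mul_left_comm, ← hcoe, Polynomial.coe_mul,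
    Polynomial.coe_pow, Polynomial.coe_X]

theorem IsHStarPolynomial.coeff_zero {S : Set (Fin d → ℝ)} {h : ℤ[X]}
    (hh : IsHStarPolynomial S h) : h.coeff 0 = 1 := by
  rw [← Polynomial.coeff_coe, hh, PowerSeries.coeff_zero_eq_constantCoeff]
  simp [ehrhartSeries]

end Homogenization

theorem mainTheorem2 {m d : ℕ} (hm : 0 < m) (M : Matrix (Fin m) (Fin d) ℤ)
    (P : Set (Fin d → ℝ)) (hP : IsRegularPositiveReflexive P M)
    (k : ℤ) (hk : ∀ i : Fin m, k = ∑ j, M i j + 1) :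
    ∃ h : Polynomial ℤ, IsHStarPolynomial P h ∧
      (h.natDegree : ℤ) = (d : ℤ) - k + 1 ∧ IsPalindromic h := by
  obtain rfl := hP.eq_polyhedron
  have hk_pos : 0 ≤ k - 1 := rowSum_nonneg hP.integral.isBounded hm fun i =>
    (sub_eq_of_eq_add (hk i)).symm
  lift k to ℕ using by lia
  obtain ⟨h, hdeg, hstar, hreflect⟩ := exists_polynomial_ehrhartSeries hm hP.integral hk
  have h0 : h.coeff 0 ≠ 0 := hstar.coeff_zero ▸ one_ne_zero
  obtain ⟨hdk, hpal⟩ := natDegree_eq_and_reverse_eq_of_reflect_eq h0 hdeg hreflect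
  exact ⟨h, hstar, by lia, hpal⟩
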